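/- All manifolds, maps and tensor fields are smooth (and manifolds are without boundary). An almost hypercomplex structure with Hermitian and Norden metrics on a $4n$-dimensional manifold $\overline M$ consists of tangent bundle endomorphisms $J_1,J_2,J_3$ with $J_\alpha^2=-I$ and $J_\alpha=J_\beta J_\gamma=-J_\gamma J_\beta$ for every cyclic permutation $(\alpha,\beta,\gamma)$ of $(1,2,3)$, and of a pseudo-Riemannian metric $g$ with $$g(J_1X,J_1Y)=-g(J_2X,J_2Y)=-g(J_3X,J_3Y)=g(X,Y),$$ together with the associated forms $g_\alpha(X,Y)=g(J_\alpha X,Y)$, $\alpha=1,2,3$. It is a $\mathcal K$-manifold (a hyper-Kähler manifold with Hermitian and Norden metrics) if $\nabla J_\alpha=0$ for $\alpha=1,2,3$, where $\nabla$ is the Levi-Civita connection of $g$. A holomorphic submanifold of $\overline M$ is an (immersed) $4m$-dimensional submanifold $M$ such that $J_\alpha(T_pM)=T_pM$ for all $p\in M$ and $\alpha=1,2,3$, and such that the restriction of $g$ to $T_pM$ is nondegenerate for all $p\in M$. **Corollary.** Let $M$ be a holomorphic submanifold of a $\mathcal K$-manifold $\overline M$. Then the restrictions of $J_1,J_2,J_3$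 and $g$ to $TM$ form an almost hypercomplex structure with Hermitian and Norden metrics on $M$, with which $M$ is a $\mathcal K$-manifold, and $M$ is totally geodesic in $\overline M$: if $\overline\nabla$ and $\nabla$ are the Levi-Civita connections of $\overline M$ and of $M$ (with the restricted metric), then the second fundamental form $h(X,Y)=\overline\nabla_XY-\nabla_XY$ vanishes for all vector fields $X,Y$ on $M$. -/

import Mathlib

open Bundle Manifold ContDiff Topology

noncomputable section

namespace HyperHN

section Structures

variable {E : Type*} [NormedAddCommGroup E] [NormedSpace ℝ E]
  {H : Type*} [TopologicalSpace H] (I : ModelWithCorners ℝ E H)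
  (M : Type*) [TopologicalSpace M] [ChartedSpace H M] [IsManifold I ∞ M]

/-- A (smooth) pseudo-Riemannian metric: a smooth field of symmetric nondegenerate
bilinear forms on the tangent spaces. -/
structure PseudoRiemannianMetric where
  /-- the bilinear form on each tangent space -/
  form : ∀ x : M, TangentSpace I x →L[ℝ] TangentSpace I x →L[ℝ] ℝ
  symm : ∀ (x : M) (v w : TangentSpace I x), form x v w = form x w v
  nondegenerate : ∀ (x : M) (v : TangentSpace I x),
    (∀ w : TangentSpace I x, form x v w = 0) → v = 0
  smooth : ContMDiff I (I.prod 𝓘(ℝ, E →L[ℝ] E →L[ℝ] ℝ)) ∞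
    (fun x ↦ TotalSpace.mk' (E →L[ℝ] E →L[ℝ] ℝ)
      (E := fun x : M ↦ TangentSpace I x →L[ℝ] TangentSpace I x →L[ℝ] ℝ) x (form x))

/-- An almost hypercomplex structure `(J₁, J₂, J₃)`, here indexed as `J 0, J 1, J 2`: smooth fields
of endomorphisms of the tangent spaces with `J_α² = -1` and `J_α = J_β J_γ = -J_γ J_β` for every
cyclic permutation `(α, β, γ)` (the index set `Fin 3` carries addition modulo 3). -/
structure AlmostHypercomplexStructure where
  /-- the three almost complex structures -/
  J : Fin 3 → ∀ x : M, TangentSpace I x →L[ℝ] TangentSpace I x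
  sq_eq : ∀ (α : Fin 3) (x : M) (v : TangentSpace I x), J α x (J α x v) = -v
  eq_comp : ∀ (α : Fin 3) (x : M) (v : TangentSpace I x),
    J α x v = J (α + 1) x (J (α + 2) x v)
  eq_neg_comp : ∀ (α : Fin 3) (x : M) (v : TangentSpace I x),
    J α x v = -J (α + 2) x (J (α + 1) x v)
  smooth : ∀ α : Fin 3, ContMDiff I (I.prod 𝓘(ℝ, E →L[ℝ] E)) ∞
    (fun x ↦ TotalSpace.mk' (E →L[ℝ] E)
      (E := fun x : M ↦ TangentSpace I x →L[ℝ] TangentSpace I x) x (J α x))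

/-- An almost hypercomplex structure with Hermitian and Norden metrics: a pseudo-Riemannian metric
`g` which is Hermitian with respect to `J₁` and Norden with respect to `J₂` and `J₃`. The
remaining members `g₁, g₂, g₃` of the metric structure are determined by `g` and the `J_α`, see
`HermitianNordenStructure.associatedForm`. -/
structure HermitianNordenStructure extends AlmostHypercomplexStructure I M where
  /-- the metric `g` -/
  g : PseudoRiemannianMetric I M
  hermitian : ∀ (x : M) (v w : TangentSpace I x),
    g.form x (J 0 x v) (J 0 x w) = g.form x v w
  norden₂ : ∀ (x : M) (v w : TangentSpace I x),
    g.form x (J 1 x v) (J 1 x w) = -g.form x v w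
  norden₃ : ∀ (x : M) (v w : TangentSpace I x),
    g.form x (J 2 x v) (J 2 x w) = -g.form x v w

variable {I M}

/-- The associated bilinear forms `g_α(X, Y) = g(J_α X, Y)`. -/
def HermitianNordenStructure.associatedForm (S : HermitianNordenStructure I M) (α : Fin 3)
    (x : M) (v w : TangentSpace I x) : ℝ :=
  S.g.form x (S.J α x v) w

variable [FiniteDimensional ℝ E]

/-- `∇` is the Levi-Civita connection of `g`: it is torsion-free and metric, i.e.
`X g(Y, Z) = g(∇_X Y, Z) + g(Y, ∇_X Z)`. (In Mathlib `cov Y x v` stands for `(∇_v Y)(x)`.)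
It exists and its values on vector fields differentiable at a point are unique. -/
structure PseudoRiemannianMetric.IsLeviCivita (g : PseudoRiemannianMetric I M)
    (cov : CovariantDerivative I E (TangentSpace I : M → Type _)) : Prop where
  torsion_free : cov.torsion = 0
  metric : ∀ (x : M) (v : TangentSpace I x) (Y Z : ∀ y : M, TangentSpace I y),
    MDiffAt (T% Y) x →
    MDiffAt (T% Z) x →
    mvfderiv I (fun y ↦ g.form y (Y y) (Z y)) x v =
      g.form x (cov Y x v) (Z x) + g.form x (Y x) (cov Z x v)

/-- A field of endomorphisms `J` is parallel, `∇J = 0`: `∇_v (J Y) = J (∇_v Y)`. -/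
def IsParallel (cov : CovariantDerivative I E (TangentSpace I : M → Type _))
    (J : ∀ x : M, TangentSpace I x →L[ℝ] TangentSpace I x) : Prop :=
  ∀ (x : M) (v : TangentSpace I x) (Y : ∀ y : M, TangentSpace I y),
    MDiffAt (T% Y) x →
    cov (fun y ↦ J y (Y y)) x v - J x (cov Y x v) = 0

/-- `K`-manifolds (hyper-Kähler manifolds with Hermitian and Norden metrics): the `J_α` are
parallel for the Levi-Civita connection of `g`. -/
def HermitianNordenStructure.IsKManifold (S : HermitianNordenStructure I M) : Prop :=
  ∃ cov : CovariantDerivative I E (TangentSpace I : M → Type _),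
    S.g.IsLeviCivita cov ∧ ∀ α : Fin 3, IsParallel cov (S.J α)

end Structures

section Submanifolds

variable {E : Type*} [NormedAddCommGroup E] [NormedSpace ℝ E]
  {H : Type*} [TopologicalSpace H] {I : ModelWithCorners ℝ E H}
  {M : Type*} [TopologicalSpace M] [ChartedSpace H M]
  {E' : Type*} [NormedAddCommGroup E'] [NormedSpace ℝ E']
  {H' : Type*} [TopologicalSpace H'] {I' : ModelWithCorners ℝ E' H'}
  {N : Type*} [TopologicalSpace N] [ChartedSpace H' N] [IsManifold I' ∞ N]

/-- The covariant derivative `∇_v s` at `x` of a vector field `s` along `f : M → N`, induced by a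
connection of `N`. In the trivialization of `TN` around `f x`, it is the sum of the derivative of
the components of `s` and of the covariant derivative of the vector field of `N` with the constant
components of `s x` (this is `FiberBundle.extend E' (s x)`). -/
def covAlong (f : M → N) (cov : CovariantDerivative I' E' (TangentSpace I' : N → Type _))
    (s : ∀ x : M, TangentSpace I' (f x)) (x : M) :
    TangentSpace I x →L[ℝ] TangentSpace I' (f x) :=
  letI t := trivializationAt E' (TangentSpace I' : N → Type _) (f x)
  t.symmL ℝ (f x) ∘L mvfderiv I (fun y ↦ (t (⟨f y, s y⟩ : TangentBundle I' N)).2) x +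
    cov (FiberBundle.extend E' (s x)) (f x) ∘L mfderiv I I' f x

/-- If the vector field along `f` comes from a vector field `W` of `N`, then its covariant
derivative along `f` is that of `W`, `∇_v (W ∘ f) = ∇_{df(v)} W`. -/
theorem covAlong_comp [FiniteDimensional ℝ E'] (f : M → N)
    (cov : CovariantDerivative I' E' (TangentSpace I' : N → Type _))
    (W : ∀ z : N, TangentSpace I' z) (x : M) (v : TangentSpace I x)
    (hf : MDifferentiableAt I I' f x) (hW : MDiffAt (T% W) (f x)) :
    covAlong f cov (fun y ↦ W (f y)) x v = cov W (f x) (mfderiv I I' f x v) := by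
  set p := f x with hp
  set t := trivializationAt E' (TangentSpace I' : N → Type _) p with ht
  have hpt : p ∈ t.baseSet := FiberBundle.mem_baseSet_trivializationAt' p
  have hev : ∀ᶠ z in 𝓝 p, z ∈ t.baseSet := t.open_baseSet.mem_nhds hpt
  have key (σ : ∀ z : N, TangentSpace I' z) (hσ : MDiffAt (T% σ) p) :
      MDifferentiableAt I' 𝓘(ℝ, E') (fun z ↦ (t ⟨z, σ z⟩).2) p :=
    (mdifferentiableAt_section ..).1 hσ
  let D : (∀ z : N, TangentSpace I' z) → (TangentSpace I' p →L[ℝ] TangentSpace I' p) := fun σ ↦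
    cov σ p - t.symmL ℝ p ∘L mvfderiv I' (fun z ↦ (t ⟨z, σ z⟩).2) p
  have congr_d {a b : N → E'} (h : a =ᶠ[𝓝 p] b) : mvfderiv I' a p = mvfderiv I' b p := by
    ext w
    have := h.mfderiv_eq (I := I') (I' := 𝓘(ℝ, E'))
    exact congr($this w)
  have hT : TensorialAt I' E' D p := by
    constructor
    · intro g σ hg hσ
      have e1 : (fun z ↦ (t ⟨z, (g • σ) z⟩).2) =ᶠ[𝓝 p] fun z ↦ g z • (t ⟨z, σ z⟩).2 := by
        filter_upwards [hev] with z hz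
        simpa using (t.linear ℝ hz).map_smul (g z) (σ z)
      have h3 : t.symmL ℝ p (t ⟨p, σ p⟩).2 = σ p := by
        simpa [t.symmL_apply hpt] using t.symm_apply_apply_mk hpt (σ p)
      ext w
      simp only [D]
      rw [congr_d e1, mvfderiv_fun_smul hg (key σ hσ),
        cov.isCovariantDerivativeOnUniv.leibniz hσ hg]
      simp [h3]
      module
    · intro σ τ hσ hτ
      have e1 : (fun z ↦ (t ⟨z, (σ + τ) z⟩).2) =ᶠ[𝓝 p]
          fun z ↦ (t ⟨z, σ z⟩).2 + (t ⟨z, τ z⟩).2 := by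
        filter_upwards [hev] with z hz
        simpa using (t.linear ℝ hz).map_add (σ z) (τ z)
      ext w
      simp only [D]
      rw [congr_d e1, mvfderiv_fun_add (key σ hσ) (key τ hτ),
        cov.isCovariantDerivativeOnUniv.add hσ hτ]
      simp
      abel
  have hpw := hT.pointwise (FiberBundle.mdifferentiableAt_extend I' E' (W p)) hW (by simp)
  have hz : mvfderiv I' (fun z ↦ (t ⟨z, FiberBundle.extend E' (W p) z⟩).2) p = 0 := by
    have e1 : (fun z ↦ (t ⟨z, FiberBundle.extend E' (W p) z⟩).2) =ᶠ[𝓝 p]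
        fun _ ↦ (t ⟨p, W p⟩).2 := by
      filter_upwards [hev] with z hz
      simp [FiberBundle.extend, ← ht, t.apply_mk_symm hz]
    rw [congr_d e1]
    simp [mvfderiv]
  have hc : mvfderiv I (fun y ↦ (t ⟨f y, W (f y)⟩).2) x v =
      mvfderiv I' (fun z ↦ (t ⟨z, W z⟩).2) p (mfderiv I I' f x v) :=
    congr($(mfderiv_comp x (key W hW) hf) v)
  simp only [D] at hpw
  rw [hz, ContinuousLinearMap.comp_zero, sub_zero] at hpw
  simp only [covAlong, ← hp, ← ht, add_apply, ContinuousLinearMap.comp_apply]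
  rw [hc, hpw]
  exact add_sub_cancel _ _

variable [IsManifold I ∞ M]

/-- `M`, immersed in `N` by `f`, is a holomorphic submanifold: the tangent spaces of `M` are
preserved by the `J_α`, `J_α (T_x M) = T_x M`, and the restriction of `g` to them is
nondegenerate. Here `T_x M` is seen in `T_{f x} N` as the range of the differential of `f`. -/
structure IsHolomorphicSubmanifold (S : HermitianNordenStructure I' N) (f : M → N) : Prop where
  immersion : IsImmersion I I' ∞ f
  map_tangent : ∀ (α : Fin 3) (x : M),
    Submodule.map (S.J α (f x) : TangentSpace I' (f x) →ₗ[ℝ] TangentSpace I' (f x))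
      (LinearMap.range (mfderiv I I' f x : TangentSpace I x →ₗ[ℝ] TangentSpace I' (f x))) =
      LinearMap.range (mfderiv I I' f x : TangentSpace I x →ₗ[ℝ] TangentSpace I' (f x))
  nondegenerate : ∀ (x : M) (v : TangentSpace I x),
    (∀ w : TangentSpace I x, S.g.form (f x) (mfderiv I I' f x v) (mfderiv I I' f x w) = 0) → v = 0

/-- `S` is the restriction to `M` of the structure `S'` of `N` along the immersion `f`. As the
differentials of `f` are injective, there is at most one such `S`. -/
structure IsRestriction (f : M → N) (S' : HermitianNordenStructure I' N)
    (S : HermitianNordenStructure I M) : Prop where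
  J_eq : ∀ (α : Fin 3) (x : M) (v : TangentSpace I x),
    mfderiv I I' f x (S.J α x v) = S'.J α (f x) (mfderiv I I' f x v)
  g_eq : ∀ (x : M) (v w : TangentSpace I x),
    S.g.form x v w = S'.g.form (f x) (mfderiv I I' f x v) (mfderiv I I' f x w)

/-- The second fundamental form `h(X, Y)` at `x`, for `v = X x`, through the Gauss formula
`∇̄_X Y = ∇_X Y + h(X, Y)`, where `∇̄`, `∇` are the connections `cov'` of `N` and `cov` of `M`. -/
def secondFundamentalForm (f : M → N)
    (cov' : CovariantDerivative I' E' (TangentSpace I' : N → Type _))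
    (cov : CovariantDerivative I E (TangentSpace I : M → Type _))
    (x : M) (v : TangentSpace I x) (Y : ∀ y : M, TangentSpace I y) : TangentSpace I' (f x) :=
  covAlong f cov' (fun y ↦ mfderiv I I' f y (Y y)) x v - mfderiv I I' f x (cov Y x v)

/-- `M`, with the metric `g`, is totally geodesic in `N`, with the metric `g'`: the second
fundamental form, for the Levi-Civita connections, vanishes. -/
def IsTotallyGeodesic [FiniteDimensional ℝ E] [FiniteDimensional ℝ E'] (f : M → N)
    (g' : PseudoRiemannianMetric I' N) (g : PseudoRiemannianMetric I M) : Prop :=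
  ∀ (cov' : CovariantDerivative I' E' (TangentSpace I' : N → Type _))
    (cov : CovariantDerivative I E (TangentSpace I : M → Type _)),
    g'.IsLeviCivita cov' → g.IsLeviCivita cov →
    ∀ (x : M) (v : TangentSpace I x) (Y : ∀ y : M, TangentSpace I y),
      MDiffAt (T% Y) x →
      secondFundamentalForm f cov' cov x v Y = 0

end Submanifolds

end HyperHN

end

noncomputable section

namespace HyperHN

section Slices

variable {E : Type*} [NormedAddCommGroup E] [NormedSpace ℝ E]
  {M : Type*} [TopologicalSpace M] [ChartedSpace E M]
  {E' : Type*} [NormedAddCommGroup E'] [NormedSpace ℝ E']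
  {N : Type*} [TopologicalSpace N] [ChartedSpace E' N]

/-- Charts in which `f` is an injective linear map `e`, with left inverse `p`. -/
structure SliceCharts (f : M → N) (x : M) where
  φ : OpenPartialHomeomorph M E
  ψ : OpenPartialHomeomorph N E'
  e : E →L[ℝ] E'
  p : E' →L[ℝ] E
  left_inv : ∀ u, p (e u) = u
  φ_mem : φ ∈ IsManifold.maximalAtlas 𝓘(ℝ, E) ∞ M
  ψ_mem : ψ ∈ IsManifold.maximalAtlas 𝓘(ℝ, E') ∞ N
  mem_source : x ∈ φ.source
  mapsTo : Set.MapsTo f φ.source ψ.source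
  eq : ∀ y ∈ φ.source, ψ (f y) = e (φ y)

theorem exists_sliceCharts {f : M → N} (hf : IsImmersion 𝓘(ℝ, E) 𝓘(ℝ, E') ∞ f) (x : M) :
    Nonempty (SliceCharts (E := E) (E' := E') f x) := by
  obtain ⟨F, _, _, h⟩ := hf.isImmersionAt x
  refine ⟨h.domChart, h.codChart, (h.equiv : E × F →L[ℝ] E') ∘L ContinuousLinearMap.inl ℝ E F,
    ContinuousLinearMap.fst ℝ E F ∘L (h.equiv.symm : E' →L[ℝ] E × F), by simp,
    h.domChart_mem_maximalAtlas, h.codChart_mem_maximalAtlas, h.mem_domChart_source,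
    h.mapsto_domChart_source_codChart_source, fun y hy ↦ ?_⟩
  have := h.writtenInCharts ((h.domChart.extend 𝓘(ℝ, E)).map_source (x := y) (by simpa using hy))
  simpa [hy] using this

theorem ofNat_le_infty (k : ℕ) : (k : ℕ∞ω) ≤ ∞ := mod_cast (le_top : (k : ℕ∞) ≤ ⊤)

theorem isInvertible_mfderiv_of_mem_maximalAtlas {φ : OpenPartialHomeomorph M E}
    (hφ : φ ∈ IsManifold.maximalAtlas 𝓘(ℝ, E) ∞ M) {y : M} (hy : y ∈ φ.source)
    [IsManifold 𝓘(ℝ, E) ∞ M] :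
    (mfderiv 𝓘(ℝ, E) 𝓘(ℝ, E) φ y).IsInvertible := by
  have h : φ.MDifferentiable 𝓘(ℝ, E) 𝓘(ℝ, E) :=
    ⟨(contMDiffOn_of_mem_maximalAtlas hφ).mdifferentiableOn (by simp),
      (contMDiffOn_symm_of_mem_maximalAtlas hφ).mdifferentiableOn (by simp)⟩
  exact ⟨h.mfderiv hy, rfl⟩

theorem exists_retraction {f : M → N} (hf : IsImmersion 𝓘(ℝ, E) 𝓘(ℝ, E') ∞ f) (x : M) :
    ∃ r : N → M, ContMDiffAt 𝓘(ℝ, E') 𝓘(ℝ, E) ∞ r (f x) ∧ ∀ᶠ y in 𝓝 x, r (f y) = y := by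
  obtain ⟨s⟩ := exists_sliceCharts hf x
  have hs := s.mem_source
  refine ⟨fun z ↦ s.φ.symm (s.p (s.ψ z)), ?_, ?_⟩
  · have h1 := contMDiffAt_of_mem_maximalAtlas s.ψ_mem (s.mapsTo hs)
    have h2 : ContMDiffAt 𝓘(ℝ, E') 𝓘(ℝ, E) ∞ (fun z ↦ s.p (s.ψ z)) (f x) :=
      s.p.contMDiff.contMDiffAt.comp _ h1
    have h3 : s.p (s.ψ (f x)) = s.φ x := by rw [s.eq x hs, s.left_inv]
    have h4 := contMDiffAt_symm_of_mem_maximalAtlas s.φ_mem (s.φ.map_source hs)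
    rw [← h3] at h4
    exact ContMDiffAt.comp (f x) h4 h2
  · filter_upwards [s.φ.open_source.mem_nhds hs] with y hy
    rw [s.eq y hy, s.left_inv, s.φ.left_inv hy]

variable [IsManifold 𝓘(ℝ, E) ∞ M] [IsManifold 𝓘(ℝ, E') ∞ N]

/-- The constant field on the model space. -/
def modelConst (u : E) : ∀ y : E, TangentSpace 𝓘(ℝ, E) y := fun _ ↦ u

/-- The field with constant components in a chart. -/
def constField (φ : OpenPartialHomeomorph M E) (u : E) : ∀ y : M, TangentSpace 𝓘(ℝ, E) y :=
  VectorField.mpullback 𝓘(ℝ, E) 𝓘(ℝ, E) φ (modelConst u)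

theorem mdifferentiableAt_modelConst (u x : E) : MDiffAt (T% (modelConst u)) x := by
  rw [mdifferentiableAt_section]
  simpa [modelConst] using mdifferentiableAt_const

theorem mdifferentiableAt_constField [CompleteSpace E] {φ : OpenPartialHomeomorph M E}
    (hφ : φ ∈ IsManifold.maximalAtlas 𝓘(ℝ, E) ∞ M) {y : M} (hy : y ∈ φ.source) (u : E) :
    MDiffAt (T% (constField φ u)) y :=
  have : IsManifold 𝓘(ℝ, E) 3 M := .of_le (n := ∞) (ofNat_le_infty 3)
  MDifferentiableAt.mpullback_vectorField (n := 2) (mdifferentiableAt_modelConst _ _)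
    ((contMDiffAt_of_mem_maximalAtlas hφ hy).of_le (ofNat_le_infty 2))
    (isInvertible_mfderiv_of_mem_maximalAtlas hφ hy) le_rfl

theorem mlieBracket_constField [CompleteSpace E] {φ : OpenPartialHomeomorph M E}
    (hφ : φ ∈ IsManifold.maximalAtlas 𝓘(ℝ, E) ∞ M) {y : M} (hy : y ∈ φ.source) (u w : E) :
    VectorField.mlieBracket 𝓘(ℝ, E) (constField φ u) (constField φ w) y = 0 := by
  have : IsManifold 𝓘(ℝ, E) (minSmoothness ℝ 3) M := .of_le (n := ∞) (by simpa using ofNat_le_infty 3)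
  rw [constField, constField, ← VectorField.mpullback_mlieBracket (n := ∞)
    (mdifferentiableAt_modelConst _ _) (mdifferentiableAt_modelConst _ _)
    (contMDiffAt_of_mem_maximalAtlas hφ hy) (by simpa using ofNat_le_infty 2), VectorField.mpullback_apply,
    ← VectorField.mlieBracketWithin_univ, VectorField.mlieBracketWithin_eq_lieBracketWithin]
  have hc (v z : E) : fderivWithin ℝ (modelConst v) Set.univ z = 0 := by
    unfold modelConst
    exact fderivWithin_const_apply ..
  have hb : VectorField.lieBracketWithin ℝ (modelConst u) (modelConst w) Set.univ (φ y) = 0 := by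
    change fderivWithin ℝ (modelConst w) Set.univ (φ y) u -
      fderivWithin ℝ (modelConst u) Set.univ (φ y) w = 0
    rw [hc, hc]
    exact sub_self (0 : E)
  rw [hb]
  exact map_zero _

theorem mfderiv_constField {φ : OpenPartialHomeomorph M E}
    (hφ : φ ∈ IsManifold.maximalAtlas 𝓘(ℝ, E) ∞ M) {y : M} (hy : y ∈ φ.source) (u : E) :
    mfderiv 𝓘(ℝ, E) 𝓘(ℝ, E) φ y (constField φ u y) = u :=
  (isInvertible_mfderiv_of_mem_maximalAtlas hφ hy).self_apply_inverse _

theorem exists_constField_eq {φ : OpenPartialHomeomorph M E}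
    (hφ : φ ∈ IsManifold.maximalAtlas 𝓘(ℝ, E) ∞ M) {y : M} (hy : y ∈ φ.source)
    (v : TangentSpace 𝓘(ℝ, E) y) : ∃ u : E, constField φ u y = v :=
  ⟨mfderiv 𝓘(ℝ, E) 𝓘(ℝ, E) φ y v,
    (isInvertible_mfderiv_of_mem_maximalAtlas hφ hy).inverse_apply_self v⟩

/-- Fields with constant components in slice charts are `f`-related. -/
theorem SliceCharts.mfderiv_constField {f : M → N} {x : M} (s : SliceCharts (E := E) (E' := E') f x)
    (hf : ContMDiff 𝓘(ℝ, E) 𝓘(ℝ, E') ∞ f) (u : E) {y : M} (hy : y ∈ s.φ.source) :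
    mfderiv 𝓘(ℝ, E) 𝓘(ℝ, E') f y (constField s.φ u y) = constField s.ψ (s.e u) (f y) := by
  have h1 := isInvertible_mfderiv_of_mem_maximalAtlas s.ψ_mem (s.mapsTo hy)
  apply h1.injective
  rw [HyperHN.mfderiv_constField s.ψ_mem (s.mapsTo hy)]
  have hψ := (contMDiffAt_of_mem_maximalAtlas s.ψ_mem (s.mapsTo hy)).mdifferentiableAt
    (by simp : (∞ : WithTop ℕ∞) ≠ 0)
  have hφ := (contMDiffAt_of_mem_maximalAtlas s.φ_mem hy).mdifferentiableAt
    (by simp : (∞ : WithTop ℕ∞) ≠ 0)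
  have hfy := (hf y).mdifferentiableAt (by simp : (∞ : WithTop ℕ∞) ≠ 0)
  have h2 : (s.ψ ∘ f) =ᶠ[𝓝 y] (s.e ∘ s.φ) := by
    filter_upwards [s.φ.open_source.mem_nhds hy] with z hz using s.eq z hz
  have h3 := h2.mfderiv_eq (I := 𝓘(ℝ, E)) (I' := 𝓘(ℝ, E'))
  rw [mfderiv_comp y hψ hfy, mfderiv_comp y s.e.mdifferentiableAt hφ] at h3
  have h4 := congr($h3 (constField s.φ u y))
  refine Eq.trans h4 ?_
  rw [ContinuousLinearMap.comp_apply, HyperHN.mfderiv_constField s.φ_mem hy]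
  simp
  rfl

end Slices

section Along

variable {E : Type*} [NormedAddCommGroup E] [NormedSpace ℝ E]
  {M : Type*} [TopologicalSpace M] [ChartedSpace E M]
  {E' : Type*} [NormedAddCommGroup E'] [NormedSpace ℝ E']
  {N : Type*} [TopologicalSpace N] [ChartedSpace E' N]
  [IsManifold 𝓘(ℝ, E') ∞ N] {f : M → N}

/-- Differentiability at `x` of a vector field along `f`. -/
def DiffAlongAt (f : M → N) (s : ∀ y : M, TangentSpace 𝓘(ℝ, E') (f y)) (x : M) : Prop :=
  MDifferentiableAt 𝓘(ℝ, E) 𝓘(ℝ, E').tangent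
    (fun y ↦ (⟨f y, s y⟩ : TangentBundle 𝓘(ℝ, E') N)) x

theorem diffAlongAt_mfderiv [IsManifold 𝓘(ℝ, E) ∞ M] (hf : ContMDiff 𝓘(ℝ, E) 𝓘(ℝ, E') ∞ f)
    {Y : ∀ y : M, TangentSpace 𝓘(ℝ, E) y} {x : M} (hY : MDiffAt (T% Y) x) :
    DiffAlongAt (E := E) (E' := E') f (fun y ↦ mfderiv 𝓘(ℝ, E) 𝓘(ℝ, E') f y (Y y)) x := by
  have h := (hf.contMDiff_tangentMap (m := ∞) (by simp)).mdifferentiable (by simp) (⟨x, Y x⟩)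
  exact MDifferentiableAt.comp x h hY

theorem exists_extension_of_diffAlongAt (hf : IsImmersion 𝓘(ℝ, E) 𝓘(ℝ, E') ∞ f)
    {s : ∀ y : M, TangentSpace 𝓘(ℝ, E') (f y)} {x : M}
    (hs : DiffAlongAt (E := E) (E' := E') f s x) :
    ∃ W : ∀ z : N, TangentSpace 𝓘(ℝ, E') z, MDiffAt (T% W) (f x) ∧
      ∀ᶠ y in 𝓝 x, s y = W (f y) := by
  obtain ⟨r, hr, hrf⟩ := exists_retraction hf x
  set t := trivializationAt E' (TangentSpace 𝓘(ℝ, E') : N → Type _) (f x) with ht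
  have hev : ∀ᶠ z in 𝓝 (f x), z ∈ t.baseSet :=
    t.open_baseSet.mem_nhds (FiberBundle.mem_baseSet_trivializationAt' _)
  have hc := ((mdifferentiableAt_totalSpace ..).1 hs).2
  refine ⟨fun z ↦ t.symm z (t ⟨f (r z), s (r z)⟩).2, ?_, ?_⟩
  · rw [mdifferentiableAt_section]
    have h1 : MDifferentiableAt 𝓘(ℝ, E') 𝓘(ℝ, E') (fun z ↦ (t ⟨f (r z), s (r z)⟩).2) (f x) :=
      MDifferentiableAt.comp_of_eq (f := r) (x := f x) (y := x)
        (g := fun y ↦ (t (⟨f y, s y⟩ : TangentBundle 𝓘(ℝ, E') N)).2) hc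
        (hr.mdifferentiableAt (by simp)) hrf.self_of_nhds
    refine h1.congr_of_eventuallyEq ?_
    filter_upwards [hev] with z hz
    rw [← ht, t.apply_mk_symm hz]
  · filter_upwards [hrf, (hf.contMDiff.continuous.tendsto x).eventually hev] with y hy hz
    rw [hy]
    exact (t.symm_apply_apply_mk hz (s y)).symm

theorem covAlong_congr (cov : CovariantDerivative 𝓘(ℝ, E') E' (TangentSpace 𝓘(ℝ, E') : N → Type _))
    {s s' : ∀ y : M, TangentSpace 𝓘(ℝ, E') (f y)} {x : M} (h : ∀ᶠ y in 𝓝 x, s y = s' y) :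
    covAlong (I := 𝓘(ℝ, E)) f cov s x = covAlong f cov s' x := by
  have h1 : (fun y ↦ (trivializationAt E' (TangentSpace 𝓘(ℝ, E') : N → Type _) (f x)
      (⟨f y, s y⟩ : TangentBundle 𝓘(ℝ, E') N)).2) =ᶠ[𝓝 x] fun y ↦
      (trivializationAt E' (TangentSpace 𝓘(ℝ, E') : N → Type _) (f x)
      (⟨f y, s' y⟩ : TangentBundle 𝓘(ℝ, E') N)).2 := by
    filter_upwards [h] with y hy
    rw [hy]
  have h2 : mvfderiv 𝓘(ℝ, E) (fun y ↦ (trivializationAt E' (TangentSpace 𝓘(ℝ, E') : N → Type _)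
      (f x) (⟨f y, s y⟩ : TangentBundle 𝓘(ℝ, E') N)).2) x = mvfderiv 𝓘(ℝ, E) (fun y ↦
      (trivializationAt E' (TangentSpace 𝓘(ℝ, E') : N → Type _) (f x)
      (⟨f y, s' y⟩ : TangentBundle 𝓘(ℝ, E') N)).2) x := by
    ext w
    exact congr($(h1.mfderiv_eq (I := 𝓘(ℝ, E)) (I' := 𝓘(ℝ, E'))) w)
  simp only [covAlong, h2, h.self_of_nhds]

variable [FiniteDimensional ℝ E']

theorem covAlong_eq_of_extension
    (cov : CovariantDerivative 𝓘(ℝ, E') E' (TangentSpace 𝓘(ℝ, E') : N → Type _))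
    {s : ∀ y : M, TangentSpace 𝓘(ℝ, E') (f y)} {W : ∀ z : N, TangentSpace 𝓘(ℝ, E') z} {x : M}
    (hf : MDifferentiableAt 𝓘(ℝ, E) 𝓘(ℝ, E') f x) (hW : MDiffAt (T% W) (f x))
    (h : ∀ᶠ y in 𝓝 x, s y = W (f y)) :
    covAlong (I := 𝓘(ℝ, E)) f cov s x =
      cov W (f x) ∘L mfderiv 𝓘(ℝ, E) 𝓘(ℝ, E') f x := by
  ext v
  rw [covAlong_congr cov h, covAlong_comp f cov W x v hf hW]
  rfl

variable (hf : IsImmersion 𝓘(ℝ, E) 𝓘(ℝ, E') ∞ f)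
  (cov : CovariantDerivative 𝓘(ℝ, E') E' (TangentSpace 𝓘(ℝ, E') : N → Type _))
include hf

theorem covAlong_add {s s' : ∀ y : M, TangentSpace 𝓘(ℝ, E') (f y)} {x : M}
    (hs : DiffAlongAt (E := E) (E' := E') f s x) (hs' : DiffAlongAt (E := E) (E' := E') f s' x) :
    covAlong (I := 𝓘(ℝ, E)) f cov (fun y ↦ s y + s' y) x =
      covAlong f cov s x + covAlong f cov s' x := by
  obtain ⟨W, hW, h⟩ := exists_extension_of_diffAlongAt hf hs
  obtain ⟨W', hW', h'⟩ := exists_extension_of_diffAlongAt hf hs'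
  have hfx := (hf.contMDiff x).mdifferentiableAt (by simp : (∞ : ℕ∞ω) ≠ 0)
  rw [covAlong_eq_of_extension cov hfx hW h, covAlong_eq_of_extension cov hfx hW' h',
    covAlong_eq_of_extension cov hfx (mdifferentiableAt_add_section hW hW') (by
      filter_upwards [h, h'] with y h1 h2; rw [h1, h2]; rfl),
    cov.isCovariantDerivativeOnUniv.add hW hW']
  rfl

theorem covAlong_smul {s : ∀ y : M, TangentSpace 𝓘(ℝ, E') (f y)} {g : M → ℝ} {x : M}
    (hs : DiffAlongAt (E := E) (E' := E') f s x) (hg : MDifferentiableAt 𝓘(ℝ, E) 𝓘(ℝ, ℝ) g x)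
    (v : TangentSpace 𝓘(ℝ, E) x) :
    covAlong (I := 𝓘(ℝ, E)) f cov (fun y ↦ g y • s y) x v =
      g x • covAlong f cov s x v + mvfderiv 𝓘(ℝ, E) g x v • s x := by
  obtain ⟨W, hW, h⟩ := exists_extension_of_diffAlongAt hf hs
  obtain ⟨r, hr, hrf⟩ := exists_retraction hf x
  have hfx := (hf.contMDiff x).mdifferentiableAt (by simp : (∞ : ℕ∞ω) ≠ 0)
  have hgr : MDifferentiableAt 𝓘(ℝ, E') 𝓘(ℝ, ℝ) (g ∘ r) (f x) :=
    MDifferentiableAt.comp_of_eq (f x) hg (hr.mdifferentiableAt (by simp)) hrf.self_of_nhds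
  have hd : mvfderiv 𝓘(ℝ, E') (g ∘ r) (f x) (mfderiv 𝓘(ℝ, E) 𝓘(ℝ, E') f x v) =
      mvfderiv 𝓘(ℝ, E) g x v := by
    rw [← mvfderiv_comp_apply x hgr hfx]
    have : (g ∘ r) ∘ f =ᶠ[𝓝 x] g := by
      filter_upwards [hrf] with y hy
      simp [hy]
    exact congr($(this.mfderiv_eq (I := 𝓘(ℝ, E)) (I' := 𝓘(ℝ, ℝ))) v)
  rw [covAlong_eq_of_extension cov hfx hW h,
    covAlong_eq_of_extension cov hfx (hgr.smul_section hW) (by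
      filter_upwards [h, hrf] with y h1 h2; simp [h1, h2]),
    cov.isCovariantDerivativeOnUniv.leibniz hW hgr]
  simp [hd, hrf.self_of_nhds, h.self_of_nhds]

theorem covAlong_parallel {J : ∀ z : N, TangentSpace 𝓘(ℝ, E') z →L[ℝ] TangentSpace 𝓘(ℝ, E') z}
    (hJ : IsParallel cov J)
    (hJs : ∀ z, MDifferentiableAt 𝓘(ℝ, E') (𝓘(ℝ, E').prod 𝓘(ℝ, E' →L[ℝ] E'))
      (fun x ↦ TotalSpace.mk' (E' →L[ℝ] E')
        (E := fun x : N ↦ TangentSpace 𝓘(ℝ, E') x →L[ℝ] TangentSpace 𝓘(ℝ, E') x) x (J x)) z)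
    {s : ∀ y : M, TangentSpace 𝓘(ℝ, E') (f y)} {x : M}
    (hs : DiffAlongAt (E := E) (E' := E') f s x) (v : TangentSpace 𝓘(ℝ, E) x) :
    covAlong (I := 𝓘(ℝ, E)) f cov (fun y ↦ J (f y) (s y)) x v =
      J (f x) (covAlong f cov s x v) := by
  obtain ⟨W, hW, h⟩ := exists_extension_of_diffAlongAt hf hs
  have hfx := (hf.contMDiff x).mdifferentiableAt (by simp : (∞ : ℕ∞ω) ≠ 0)
  rw [covAlong_eq_of_extension cov hfx hW h,
    covAlong_eq_of_extension (W := fun z ↦ J z (W z)) cov hfx ((hJs _).clm_bundle_apply hW) (by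
      filter_upwards [h] with y h1; rw [h1])]
  exact sub_eq_zero.1 (hJ (f x) _ W hW)

theorem mvfderiv_metric_along {g : PseudoRiemannianMetric 𝓘(ℝ, E') N} (hg : g.IsLeviCivita cov)
    {s s' : ∀ y : M, TangentSpace 𝓘(ℝ, E') (f y)} {x : M}
    (hs : DiffAlongAt (E := E) (E' := E') f s x) (hs' : DiffAlongAt (E := E) (E' := E') f s' x)
    (v : TangentSpace 𝓘(ℝ, E) x) :
    mvfderiv 𝓘(ℝ, E) (fun y ↦ g.form (f y) (s y) (s' y)) x v =
      g.form (f x) (covAlong f cov s x v) (s' x) + g.form (f x) (s x) (covAlong f cov s' x v) := by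
  obtain ⟨W, hW, h⟩ := exists_extension_of_diffAlongAt hf hs
  obtain ⟨W', hW', h'⟩ := exists_extension_of_diffAlongAt hf hs'
  have hfx := (hf.contMDiff x).mdifferentiableAt (by simp : (∞ : ℕ∞ω) ≠ 0)
  have hd : MDifferentiableAt 𝓘(ℝ, E') 𝓘(ℝ, ℝ) (fun z ↦ g.form z (W z) (W' z)) (f x) := by
    have := MDifferentiableAt.clm_bundle_apply₂ (F₁ := E') (F₂ := E') (F₃ := ℝ)
      (E₃ := fun _ : N ↦ ℝ)
      ((g.smooth (f x)).mdifferentiableAt (by simp)) hW hW'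
    simpa using (mdifferentiableAt_section ..).1 this
  rw [covAlong_eq_of_extension cov hfx hW h, covAlong_eq_of_extension cov hfx hW' h']
  have he : (fun y ↦ g.form (f y) (s y) (s' y)) =ᶠ[𝓝 x]
      (fun z ↦ g.form z (W z) (W' z)) ∘ f := by
    filter_upwards [h, h'] with y h1 h2
    simp [h1, h2]
  refine congr($(he.mfderiv_eq (I := 𝓘(ℝ, E)) (I' := 𝓘(ℝ, ℝ))) v).trans ?_
  refine (mvfderiv_comp_apply x hd hfx v).trans ?_
  rw [hg.metric _ _ W W' hW hW', h.self_of_nhds, h'.self_of_nhds]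
  rfl

end Along

section HomFields

variable {E : Type*} [NormedAddCommGroup E] [NormedSpace ℝ E] [FiniteDimensional ℝ E]
  {H : Type*} [TopologicalSpace H] {I : ModelWithCorners ℝ E H}
  {M : Type*} [TopologicalSpace M] [ChartedSpace H M]
  {F : Type*} [NormedAddCommGroup F] [NormedSpace ℝ F]

theorem contMDiffAt_clm_of_apply {φ : M → E →L[ℝ] F} {x : M}
    (h : ∀ u : E, ContMDiffAt I 𝓘(ℝ, F) ∞ (fun y ↦ φ y u) x) :
    ContMDiffAt I 𝓘(ℝ, E →L[ℝ] F) ∞ φ x := by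
  let b := Module.finBasis ℝ E
  have he : φ = fun y ↦ ∑ i, ContinuousLinearMap.smulRightL ℝ E F
      (LinearMap.toContinuousLinearMap (b.coord i)) (φ y (b i)) := by
    ext y u
    conv_lhs => rw [← b.sum_repr u, map_sum]
    simp
  rw [he]
  refine ContMDiffAt.sum fun i _ ↦ ?_
  exact (ContinuousLinearMap.contMDiff _).contMDiffAt.comp x (h (b i))

variable [IsManifold I ∞ M]

theorem contMDiffAt_endomorphism_of_apply {A : ∀ y : M, TangentSpace I y →L[ℝ] TangentSpace I y}
    {x : M} (h : ∀ Y : ∀ y : M, TangentSpace I y, ContMDiffAt I I.tangent ∞ (T% Y) x →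
      ContMDiffAt I I.tangent ∞ (T% (fun y ↦ A y (Y y))) x) :
    ContMDiffAt I (I.prod 𝓘(ℝ, E →L[ℝ] E)) ∞
      (fun y ↦ TotalSpace.mk' (E →L[ℝ] E)
        (E := fun y : M ↦ TangentSpace I y →L[ℝ] TangentSpace I y) y (A y)) x := by
  rw [contMDiffAt_hom_bundle]
  refine ⟨contMDiffAt_id, contMDiffAt_clm_of_apply fun u ↦ ?_⟩
  set t := trivializationAt E (TangentSpace I : M → Type _) x with ht
  have hx : x ∈ t.baseSet := FiberBundle.mem_baseSet_trivializationAt' x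
  have hs : ContMDiffAt I I.tangent ∞ (T% (fun y ↦ t.symm y u)) x := by
    have := FiberBundle.contMDiffAt_extend (k := ∞) I E (t.symm x u : TangentSpace I x)
    simpa only [FiberBundle.extend, ← ht, t.apply_mk_symm hx] using this
  refine ((contMDiffAt_section ..).1 (h _ hs)).congr_of_eventuallyEq ?_
  filter_upwards [t.open_baseSet.mem_nhds hx] with y hy
  rw [ContinuousLinearMap.inCoordinates_eq hy hy]
  rfl

theorem contMDiffAt_form_of_apply {G : ∀ y : M, TangentSpace I y →L[ℝ] TangentSpace I y →L[ℝ] ℝ}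
    {x : M} (h : ∀ Y Z : ∀ y : M, TangentSpace I y, ContMDiffAt I I.tangent ∞ (T% Y) x →
      ContMDiffAt I I.tangent ∞ (T% Z) x →
      ContMDiffAt I 𝓘(ℝ, ℝ) ∞ (fun y ↦ G y (Y y) (Z y)) x) :
    ContMDiffAt I (I.prod 𝓘(ℝ, E →L[ℝ] E →L[ℝ] ℝ)) ∞
      (fun y ↦ TotalSpace.mk' (E →L[ℝ] E →L[ℝ] ℝ)
        (E := fun y : M ↦ TangentSpace I y →L[ℝ] TangentSpace I y →L[ℝ] ℝ) y (G y)) x := by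
  rw [contMDiffAt_hom_bundle]
  refine ⟨contMDiffAt_id, contMDiffAt_clm_of_apply fun u ↦ contMDiffAt_clm_of_apply fun w ↦ ?_⟩
  set t := trivializationAt E (TangentSpace I : M → Type _) x with ht
  have hx : x ∈ t.baseSet := FiberBundle.mem_baseSet_trivializationAt' x
  have hs (u : E) : ContMDiffAt I I.tangent ∞ (T% (fun y ↦ t.symm y u)) x := by
    have := FiberBundle.contMDiffAt_extend (k := ∞) I E (t.symm x u : TangentSpace I x)
    simpa only [FiberBundle.extend, ← ht, t.apply_mk_symm hx] using this
  refine (h _ _ (hs u) (hs w)).congr_of_eventuallyEq ?_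
  filter_upwards [t.open_baseSet.mem_nhds hx] with y hy
  refine (inCoordinates_apply_eq₂ (F₃ := ℝ) (E₃ := fun _ : M ↦ ℝ) hy hy (by simp)).trans ?_
  simp
  rfl

end HomFields

section Uniqueness

variable {E : Type*} [NormedAddCommGroup E] [NormedSpace ℝ E] [FiniteDimensional ℝ E]
  {H : Type*} [TopologicalSpace H] {I : ModelWithCorners ℝ E H}
  {M : Type*} [TopologicalSpace M] [ChartedSpace H M] [IsManifold I ∞ M]

theorem PseudoRiemannianMetric.IsLeviCivita.unique {g : PseudoRiemannianMetric I M}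
    {c c' : CovariantDerivative I E (TangentSpace I : M → Type _)}
    (h : g.IsLeviCivita c) (h' : g.IsLeviCivita c') {x : M} {Y : ∀ y : M, TangentSpace I y}
    (hY : MDiffAt (T% Y) x) : c Y x = c' Y x := by
  have hT : TensorialAt I E (fun Y ↦ c Y x - c' Y x) x := by
    constructor
    · intro a σ ha hσ
      simp only [c.isCovariantDerivativeOnUniv.leibniz hσ ha,
        c'.isCovariantDerivativeOnUniv.leibniz hσ ha]
      module
    · intro σ τ hσ hτ
      simp only [c.isCovariantDerivativeOnUniv.add hσ hτ, c'.isCovariantDerivativeOnUniv.add hσ hτ]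
      abel
  let e (v : TangentSpace I x) : ∀ y : M, TangentSpace I y := FiberBundle.extend E v
  have he (v : TangentSpace I x) : MDiffAt (T% (e v)) x :=
    FiberBundle.mdifferentiableAt_extend I E v
  have hex (v : TangentSpace I x) : e v x = v := FiberBundle.extend_apply_self E v
  let T (v w z : TangentSpace I x) : ℝ := g.form x (c (e w) x v - c' (e w) x v) z
  have hsym (v w z) : T v w z = T w v z := by
    have h1 := CovariantDerivative.torsion_eq_zero_iff _ |>.1 h.torsion_free (he v) (he w)
    have h2 := CovariantDerivative.torsion_eq_zero_iff _ |>.1 h'.torsion_free (he v) (he w)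
    simp only [hex] at h1 h2
    have h3 : c (e w) x v - c' (e w) x v = c (e v) x w - c' (e v) x w := by
      rw [sub_eq_sub_iff_sub_eq_sub, h1, h2]
    simp only [T, h3]
  have hskew (v w z) : T v w z = -T v z w := by
    have h1 := h.metric x v _ _ (he w) (he z)
    have h2 := h'.metric x v _ _ (he w) (he z)
    rw [h1] at h2
    simp only [hex] at h2
    have h3 := g.symm x w (c (e z) x v)
    have h4 := g.symm x w (c' (e z) x v)
    simp only [T, map_sub, sub_apply]
    linarith
  have hT0 (v w z) : T v w z = 0 := by
    have h1 := hskew v w z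
    have h2 := hsym v z w
    have h3 := hskew z v w
    have h4 := hsym z w v
    have h5 := hskew w z v
    have h6 := hsym w v z
    linarith
  have hp := hT.pointwise hY (he (Y x)) (hex _).symm
  ext v
  have h0 : c (e (Y x)) x v - c' (e (Y x)) x v = 0 :=
    g.nondegenerate x _ fun z ↦ hT0 v (Y x) z
  exact sub_eq_zero.1 (congr($hp v).trans h0)

end Uniqueness

section Restriction

variable {E : Type*} [NormedAddCommGroup E] [NormedSpace ℝ E]
  {M : Type*} [TopologicalSpace M] [ChartedSpace E M]
  {E' : Type*} [NormedAddCommGroup E'] [NormedSpace ℝ E']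
  {N : Type*} [TopologicalSpace N] [ChartedSpace E' N]
  {f : M → N}

theorem tangentMap_retraction (hf : ContMDiff 𝓘(ℝ, E) 𝓘(ℝ, E') ∞ f) {r : N → M} {y : M}
    (hr : MDifferentiableAt 𝓘(ℝ, E') 𝓘(ℝ, E) r (f y)) (hrf : ∀ᶠ z in 𝓝 y, r (f z) = z)
    (w : TangentSpace 𝓘(ℝ, E) y) :
    (⟨r (f y), mfderiv 𝓘(ℝ, E') 𝓘(ℝ, E) r (f y) (mfderiv 𝓘(ℝ, E) 𝓘(ℝ, E') f y w)⟩ :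
      TangentBundle 𝓘(ℝ, E) M) = ⟨y, w⟩ := by
  have hfy := (hf y).mdifferentiableAt (by simp : (∞ : ℕ∞ω) ≠ 0)
  have h1 : mfderiv 𝓘(ℝ, E) 𝓘(ℝ, E) (r ∘ f) y = mfderiv 𝓘(ℝ, E) 𝓘(ℝ, E) id y :=
    Filter.EventuallyEq.mfderiv_eq (f := (id : M → M)) hrf
  rw [mfderiv_comp y hr hfy, mfderiv_id] at h1
  have h2 : mfderiv 𝓘(ℝ, E') 𝓘(ℝ, E) r (f y) (mfderiv 𝓘(ℝ, E) 𝓘(ℝ, E') f y w) = w :=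
    congr($h1 w)
  rw [h2, hrf.self_of_nhds]

theorem exists_leftInverse_mfderiv (hf : IsImmersion 𝓘(ℝ, E) 𝓘(ℝ, E') ∞ f) (x : M) :
    ∃ P : TangentSpace 𝓘(ℝ, E') (f x) →L[ℝ] TangentSpace 𝓘(ℝ, E) x,
      ∀ v, P (mfderiv 𝓘(ℝ, E) 𝓘(ℝ, E') f x v) = v := by
  obtain ⟨r, hr, hrf⟩ := exists_retraction hf x
  have hr' := hr.mdifferentiableAt (by simp : (∞ : ℕ∞ω) ≠ 0)
  have hfy := (hf.contMDiff x).mdifferentiableAt (by simp : (∞ : ℕ∞ω) ≠ 0)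
  refine ⟨mfderiv 𝓘(ℝ, E') 𝓘(ℝ, E) r (f x), fun v ↦ ?_⟩
  have h1 : mfderiv 𝓘(ℝ, E) 𝓘(ℝ, E) (r ∘ f) x = mfderiv 𝓘(ℝ, E) 𝓘(ℝ, E) id x :=
    Filter.EventuallyEq.mfderiv_eq (f := (id : M → M)) hrf
  rw [mfderiv_comp x hr' hfy, mfderiv_id] at h1
  exact congr($h1 v)

/-- A left inverse of the differential of an immersion. -/
def leftInverse (hf : IsImmersion 𝓘(ℝ, E) 𝓘(ℝ, E') ∞ f) (x : M) :
    TangentSpace 𝓘(ℝ, E') (f x) →L[ℝ] TangentSpace 𝓘(ℝ, E) x :=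
  (exists_leftInverse_mfderiv hf x).choose

@[simp]
theorem leftInverse_mfderiv (hf : IsImmersion 𝓘(ℝ, E) 𝓘(ℝ, E') ∞ f) (x : M)
    (v : TangentSpace 𝓘(ℝ, E) x) : leftInverse hf x (mfderiv 𝓘(ℝ, E) 𝓘(ℝ, E') f x v) = v :=
  (exists_leftInverse_mfderiv hf x).choose_spec v

theorem mfderiv_injective (hf : IsImmersion 𝓘(ℝ, E) 𝓘(ℝ, E') ∞ f) (x : M) :
    Function.Injective (mfderiv 𝓘(ℝ, E) 𝓘(ℝ, E') f x) :=
  Function.LeftInverse.injective (leftInverse_mfderiv hf x)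

variable [IsManifold 𝓘(ℝ, E) ∞ M] [IsManifold 𝓘(ℝ, E') ∞ N]

theorem contMDiffAt_mfderiv_field (hf : ContMDiff 𝓘(ℝ, E) 𝓘(ℝ, E') ∞ f)
    {Y : ∀ y : M, TangentSpace 𝓘(ℝ, E) y} {x : M}
    (hY : ContMDiffAt 𝓘(ℝ, E) 𝓘(ℝ, E).tangent ∞ (T% Y) x) :
    ContMDiffAt 𝓘(ℝ, E) 𝓘(ℝ, E').tangent ∞
      (fun y ↦ (⟨f y, mfderiv 𝓘(ℝ, E) 𝓘(ℝ, E') f y (Y y)⟩ : TangentBundle 𝓘(ℝ, E') N)) x :=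
  ((hf.contMDiff_tangentMap (m := ∞) (by simp)) _).comp x hY

theorem contMDiffAt_of_mfderiv_field (hf : IsImmersion 𝓘(ℝ, E) 𝓘(ℝ, E') ∞ f)
    {Y : ∀ y : M, TangentSpace 𝓘(ℝ, E) y} {x : M}
    (hY : ContMDiffAt 𝓘(ℝ, E) 𝓘(ℝ, E').tangent ∞
      (fun y ↦ (⟨f y, mfderiv 𝓘(ℝ, E) 𝓘(ℝ, E') f y (Y y)⟩ : TangentBundle 𝓘(ℝ, E') N)) x) :
    ContMDiffAt 𝓘(ℝ, E) 𝓘(ℝ, E).tangent ∞ (T% Y) x := by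
  obtain ⟨r, hr, hrf⟩ := exists_retraction hf x
  have hfx := hf.contMDiff x
  have h1 := (hr.mfderiv_const (m := ∞) (by simp)).comp x hfx
  have h2 := ContMDiffAt.clm_apply_of_inCoordinates (IM := 𝓘(ℝ, E)) (IB₁ := 𝓘(ℝ, E'))
    (IB₂ := 𝓘(ℝ, E)) (F₁ := E') (F₂ := E) (E₁ := TangentSpace 𝓘(ℝ, E'))
    (E₂ := TangentSpace 𝓘(ℝ, E)) (b₁ := f) (b₂ := fun y ↦ r (f y))
    (ϕ := fun y ↦ mfderiv 𝓘(ℝ, E') 𝓘(ℝ, E) r (f y)) h1 hY (hr.comp x hfx)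
  refine h2.congr_of_eventuallyEq ?_
  have h3 : ∀ᶠ y in 𝓝 x, ContMDiffAt 𝓘(ℝ, E') 𝓘(ℝ, E) 1 r (f y) :=
    (hf.contMDiff.continuous.tendsto x).eventually
      ((contMDiffAt_iff_contMDiffAt_nhds (by simp)).1 (hr.of_le (ofNat_le_infty 1)))
  filter_upwards [h3, hrf.eventually_nhds] with y hy1 hy2
  exact (tangentMap_retraction hf.contMDiff (hy1.mdifferentiableAt (by simp)) hy2 _).symm

variable {S' : HermitianNordenStructure 𝓘(ℝ, E') N}
  (hf : IsHolomorphicSubmanifold (I := 𝓘(ℝ, E)) S' f)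

/-- The restriction of `J α` to a holomorphic submanifold. -/
def restrictJ (α : Fin 3) (x : M) : TangentSpace 𝓘(ℝ, E) x →L[ℝ] TangentSpace 𝓘(ℝ, E) x :=
  leftInverse hf.immersion x ∘L S'.J α (f x) ∘L mfderiv 𝓘(ℝ, E) 𝓘(ℝ, E') f x

omit [IsManifold 𝓘(ℝ, E) ∞ M] in
theorem mfderiv_restrictJ (α : Fin 3) (x : M) (v : TangentSpace 𝓘(ℝ, E) x) :
    mfderiv 𝓘(ℝ, E) 𝓘(ℝ, E') f x (restrictJ hf α x v) =
      S'.J α (f x) (mfderiv 𝓘(ℝ, E) 𝓘(ℝ, E') f x v) := by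
  have h := (hf.map_tangent α x).le ⟨_, ⟨v, rfl⟩, rfl⟩
  obtain ⟨w, hw⟩ := h
  replace hw : mfderiv 𝓘(ℝ, E) 𝓘(ℝ, E') f x w =
    S'.J α (f x) (mfderiv 𝓘(ℝ, E) 𝓘(ℝ, E') f x v) := hw
  simp [restrictJ, ← hw]

/-- The restriction of the metric to a holomorphic submanifold. -/
def restrictForm (f : M → N) (g : PseudoRiemannianMetric 𝓘(ℝ, E') N) (x : M) :
    TangentSpace 𝓘(ℝ, E) x →L[ℝ] TangentSpace 𝓘(ℝ, E) x →L[ℝ] ℝ :=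
  letI A : E →L[ℝ] E' := mfderiv 𝓘(ℝ, E) 𝓘(ℝ, E') f x
  letI G : E' →L[ℝ] E' →L[ℝ] ℝ := g.form (f x)
  letI B : E →L[ℝ] E →L[ℝ] ℝ := G.bilinearComp A A
  B

omit [IsManifold 𝓘(ℝ, E) ∞ M] in
@[simp]
theorem restrictForm_apply (f : M → N) (g : PseudoRiemannianMetric 𝓘(ℝ, E') N) (x : M)
    (v w : TangentSpace 𝓘(ℝ, E) x) : restrictForm f g x v w =
      g.form (f x) (mfderiv 𝓘(ℝ, E) 𝓘(ℝ, E') f x v) (mfderiv 𝓘(ℝ, E) 𝓘(ℝ, E') f x w) :=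
  rfl

variable [FiniteDimensional ℝ E]

/-- The restriction of the structure to a holomorphic submanifold. -/
def restrict : HermitianNordenStructure 𝓘(ℝ, E) M where
  J := restrictJ hf
  sq_eq α x v := mfderiv_injective hf.immersion x (by
    simp only [mfderiv_restrictJ, S'.sq_eq, map_neg])
  eq_comp α x v := mfderiv_injective hf.immersion x (by
    simp only [mfderiv_restrictJ]
    exact S'.eq_comp α _ _)
  eq_neg_comp α x v := mfderiv_injective hf.immersion x (by
    simp only [mfderiv_restrictJ, map_neg]
    exact S'.eq_neg_comp α _ _)
  smooth α x := contMDiffAt_endomorphism_of_apply fun Y hY ↦ by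
    apply contMDiffAt_of_mfderiv_field hf.immersion
    simp only [mfderiv_restrictJ]
    exact ContMDiffAt.clm_bundle_apply (b := f) (F₁ := E') (F₂ := E')
      (((S'.smooth α) (f x)).comp x (hf.immersion.contMDiff x))
      (contMDiffAt_mfderiv_field hf.immersion.contMDiff hY)
  g := {
    form := restrictForm f S'.g
    symm := fun x v w ↦ S'.g.symm _ _ _
    nondegenerate := fun x v h ↦ hf.nondegenerate x v h
    smooth := fun x ↦ contMDiffAt_form_of_apply fun Y Z hY hZ ↦ by
      have := ContMDiffAt.clm_bundle_apply₂ (b := f) (F₁ := E') (F₂ := E') (F₃ := ℝ)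
        (E₃ := fun _ : N ↦ ℝ)
        ((S'.g.smooth (f x)).comp x (hf.immersion.contMDiff x))
        (contMDiffAt_mfderiv_field hf.immersion.contMDiff hY)
        (contMDiffAt_mfderiv_field hf.immersion.contMDiff hZ)
      have := ((contMDiffAt_totalSpace ..).1 this).2
      simpa using this }
  hermitian x v w := by simp [mfderiv_restrictJ, S'.hermitian]
  norden₂ x v w := by simp [mfderiv_restrictJ, S'.norden₂]
  norden₃ x v w := by simp [mfderiv_restrictJ, S'.norden₃]

theorem isRestriction_restrict : IsRestriction f S' (restrict hf) :=
  ⟨mfderiv_restrictJ hf, fun _ _ _ ↦ rfl⟩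

end Restriction

/-- A symmetric map `β` into a module on which `j₀`, `j₁` anticommute, and such that
`β v (J w) = j (β v w)`, vanishes. -/
theorem eq_zero_of_symm_of_anticommute {V T : Type*} [AddCommGroup T] [Module ℝ T]
    {β : V → V → T} {J₀ J₁ : V → V} {j₀ j₁ : T →ₗ[ℝ] T} (hβ : ∀ v w, β v w = β w v)
    (h₀ : ∀ v w, β v (J₀ w) = j₀ (β v w)) (h₁ : ∀ v w, β v (J₁ w) = j₁ (β v w))
    (hj : ∀ a, j₀ (j₁ a) = -j₁ (j₀ a)) (hinj : ∀ a, j₀ (j₁ a) = 0 → a = 0) (v w : V) :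
    β v w = 0 := by
  have h1 : β (J₀ v) (J₁ w) = j₁ (j₀ (β v w)) := by rw [h₁, hβ, h₀, hβ]
  have h2 : β (J₀ v) (J₁ w) = j₀ (j₁ (β v w)) := by rw [hβ, h₀, hβ, h₁]
  apply hinj
  have h3 := hj (β v w)
  rw [← h1, h2] at h3
  have h4 : (2 : ℝ) • j₀ (j₁ (β v w)) = 0 := by rwa [two_smul, add_eq_zero_iff_eq_neg]
  exact (smul_eq_zero.1 h4).resolve_left two_ne_zero

section Induced

variable {E : Type*} [NormedAddCommGroup E] [NormedSpace ℝ E]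
  {M : Type*} [TopologicalSpace M] [ChartedSpace E M]
  {E' : Type*} [NormedAddCommGroup E'] [NormedSpace ℝ E'] [FiniteDimensional ℝ E']
  {N : Type*} [TopologicalSpace N] [ChartedSpace E' N]
  [IsManifold 𝓘(ℝ, E) ∞ M] [IsManifold 𝓘(ℝ, E') ∞ N] {f : M → N}
  (hi : IsImmersion 𝓘(ℝ, E) 𝓘(ℝ, E') ∞ f)
  (cov : CovariantDerivative 𝓘(ℝ, E') E' (TangentSpace 𝓘(ℝ, E') : N → Type _))

/-- The covariant derivative along `f` of the image of a vector field of `M`. -/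
def covMFDeriv (f : M → N)
    (cov : CovariantDerivative 𝓘(ℝ, E') E' (TangentSpace 𝓘(ℝ, E') : N → Type _))
    (Y : ∀ y : M, TangentSpace 𝓘(ℝ, E) y) (x : M) :
    TangentSpace 𝓘(ℝ, E) x →L[ℝ] TangentSpace 𝓘(ℝ, E') (f x) :=
  covAlong f cov (fun y ↦ mfderiv 𝓘(ℝ, E) 𝓘(ℝ, E') f y (Y y)) x

include hi

theorem covMFDeriv_add {Y Z : ∀ y : M, TangentSpace 𝓘(ℝ, E) y} {x : M}
    (hY : MDiffAt (T% Y) x) (hZ : MDiffAt (T% Z) x) :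
    covMFDeriv f cov (Y + Z) x = covMFDeriv f cov Y x + covMFDeriv f cov Z x := by
  have := covAlong_add hi cov (diffAlongAt_mfderiv hi.contMDiff hY)
    (diffAlongAt_mfderiv hi.contMDiff hZ)
  simpa only [covMFDeriv, Pi.add_apply, map_add] using this

theorem covMFDeriv_smul {a : M → ℝ} {Y : ∀ y : M, TangentSpace 𝓘(ℝ, E) y} {x : M}
    (ha : MDifferentiableAt 𝓘(ℝ, E) 𝓘(ℝ, ℝ) a x) (hY : MDiffAt (T% Y) x)
    (v : TangentSpace 𝓘(ℝ, E) x) :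
    covMFDeriv f cov (a • Y) x v = a x • covMFDeriv f cov Y x v +
      mvfderiv 𝓘(ℝ, E) a x v • mfderiv 𝓘(ℝ, E) 𝓘(ℝ, E') f x (Y x) := by
  have := covAlong_smul hi cov (diffAlongAt_mfderiv hi.contMDiff hY) ha v
  simpa only [covMFDeriv, Pi.smul_apply', map_smul] using this

/-- The torsion-freeness of `cov`, on fields which are constant in slice charts. -/
theorem covMFDeriv_constField_symm (hcov : cov.torsion = 0) {x : M}
    (s : SliceCharts (E := E) (E' := E') f x) (u w : E) :
    covMFDeriv f cov (constField s.φ w) x (constField s.φ u x) =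
      covMFDeriv f cov (constField s.φ u) x (constField s.φ w x) := by
  have hfx := (hi.contMDiff x).mdifferentiableAt (by simp : (∞ : ℕ∞ω) ≠ 0)
  have hx := s.mem_source
  have hd (u : E) := mdifferentiableAt_constField s.ψ_mem (s.mapsTo hx) (s.e u)
  have hr (u : E) : ∀ᶠ y in 𝓝 x, mfderiv 𝓘(ℝ, E) 𝓘(ℝ, E') f y (constField s.φ u y) =
      constField s.ψ (s.e u) (f y) := by
    filter_upwards [s.φ.open_source.mem_nhds hx] with y hy
    exact s.mfderiv_constField hi.contMDiff u hy
  have key (u w : E) : covMFDeriv f cov (constField s.φ w) x (constField s.φ u x) =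
      cov (constField s.ψ (s.e w)) (f x) (constField s.ψ (s.e u) (f x)) := by
    rw [covMFDeriv, covAlong_eq_of_extension cov hfx (hd w) (hr w), ← (hr u).self_of_nhds]
    rfl
  rw [key, key]
  have := (CovariantDerivative.torsion_eq_zero_iff _).1 hcov (hd u) (hd w)
  rwa [mlieBracket_constField s.ψ_mem (s.mapsTo hx), sub_eq_zero] at this

/-- The connection of `M` induced by a connection of `N`. -/
def inducedConnection : CovariantDerivative 𝓘(ℝ, E) E (TangentSpace 𝓘(ℝ, E) : M → Type _) where
  toFun Y x := leftInverse hi x ∘L covMFDeriv f cov Y x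
  isCovariantDerivativeOnUniv := {
    add := fun hY hZ _ ↦ by
      rw [covMFDeriv_add hi cov hY hZ, ContinuousLinearMap.comp_add]
    leibniz := fun hY ha _ ↦ by
      ext v
      simp [covMFDeriv_smul hi cov ha hY v] }

theorem inducedConnection_apply (Y : ∀ y : M, TangentSpace 𝓘(ℝ, E) y) (x : M)
    (v : TangentSpace 𝓘(ℝ, E) x) :
    inducedConnection hi cov Y x v = leftInverse hi x (covMFDeriv f cov Y x v) :=
  rfl

theorem torsion_inducedConnection [FiniteDimensional ℝ E] (hcov : cov.torsion = 0) :
    (inducedConnection hi cov).torsion = 0 := by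
  ext x v w
  obtain ⟨s⟩ := exists_sliceCharts hi x
  have hx := s.mem_source
  obtain ⟨v, rfl⟩ := exists_constField_eq s.φ_mem hx v
  obtain ⟨w, rfl⟩ := exists_constField_eq s.φ_mem hx w
  rw [CovariantDerivative.torsion_apply _
    (mdifferentiableAt_constField s.φ_mem hx _) (mdifferentiableAt_constField s.φ_mem hx _),
    mlieBracket_constField s.φ_mem hx, inducedConnection_apply, inducedConnection_apply,
    covMFDeriv_constField_symm hi cov hcov]
  simp

end Induced

section Holomorphic

variable {E : Type*} [NormedAddCommGroup E] [NormedSpace ℝ E] [FiniteDimensional ℝ E]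
  {M : Type*} [TopologicalSpace M] [ChartedSpace E M]
  {E' : Type*} [NormedAddCommGroup E'] [NormedSpace ℝ E'] [FiniteDimensional ℝ E']
  {N : Type*} [TopologicalSpace N] [ChartedSpace E' N]
  [IsManifold 𝓘(ℝ, E) ∞ M] [IsManifold 𝓘(ℝ, E') ∞ N] {f : M → N}
  {S' : HermitianNordenStructure 𝓘(ℝ, E') N}
  (hf : IsHolomorphicSubmanifold (I := 𝓘(ℝ, E)) S' f)
  {cov : CovariantDerivative 𝓘(ℝ, E') E' (TangentSpace 𝓘(ℝ, E') : N → Type _)}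
include hf

omit [FiniteDimensional ℝ E'] in
theorem mdifferentiableAt_restrictJ (α : Fin 3) {Y : ∀ y : M, TangentSpace 𝓘(ℝ, E) y} {x : M}
    (hY : MDiffAt (T% Y) x) : MDiffAt (T% (fun y ↦ restrictJ hf α y (Y y))) x :=
  (((restrict hf).smooth α x).mdifferentiableAt (by simp)).clm_bundle_apply hY

omit [FiniteDimensional ℝ E] in
theorem covMFDeriv_restrictJ {α : Fin 3} (hJ : IsParallel cov (S'.J α))
    {Y : ∀ y : M, TangentSpace 𝓘(ℝ, E) y} {x : M} (hY : MDiffAt (T% Y) x)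
    (v : TangentSpace 𝓘(ℝ, E) x) :
    covMFDeriv f cov (fun y ↦ restrictJ hf α y (Y y)) x v =
      S'.J α (f x) (covMFDeriv f cov Y x v) := by
  simp only [covMFDeriv, mfderiv_restrictJ]
  exact covAlong_parallel hf.immersion cov hJ
    (fun z ↦ (S'.smooth α z).mdifferentiableAt (by simp))
    (diffAlongAt_mfderiv hf.immersion.contMDiff hY) v

theorem covMFDeriv_mem_range (hcov : cov.torsion = 0) (hJ : ∀ α, IsParallel cov (S'.J α))
    {Y : ∀ y : M, TangentSpace 𝓘(ℝ, E) y} {x : M} (hY : MDiffAt (T% Y) x)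
    (v : TangentSpace 𝓘(ℝ, E) x) :
    covMFDeriv f cov Y x v ∈ LinearMap.range (mfderiv 𝓘(ℝ, E) 𝓘(ℝ, E') f x :
      TangentSpace 𝓘(ℝ, E) x →ₗ[ℝ] TangentSpace 𝓘(ℝ, E') (f x)) := by
  have hi := hf.immersion
  set R := LinearMap.range (mfderiv 𝓘(ℝ, E) 𝓘(ℝ, E') f x :
      TangentSpace 𝓘(ℝ, E) x →ₗ[ℝ] TangentSpace 𝓘(ℝ, E') (f x))
  let Φ (Y : ∀ y : M, TangentSpace 𝓘(ℝ, E) y) :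
      TangentSpace 𝓘(ℝ, E) x →ₗ[ℝ] TangentSpace 𝓘(ℝ, E') (f x) ⧸ R :=
    R.mkQ ∘ₗ (covMFDeriv f cov Y x : _ →ₗ[ℝ] _)
  have hΦ : TensorialAt 𝓘(ℝ, E) E Φ x := by
    constructor
    · intro a Y ha hY
      ext v
      have h0 : R.mkQ (mfderiv 𝓘(ℝ, E) 𝓘(ℝ, E') f x (Y x)) = 0 :=
        (Submodule.Quotient.mk_eq_zero R).2 ⟨Y x, rfl⟩
      change R.mkQ (covMFDeriv f cov (a • Y) x v) = a x • R.mkQ (covMFDeriv f cov Y x v)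
      rw [covMFDeriv_smul hi cov ha hY v, map_add, map_smul, map_smul, h0, smul_zero, add_zero]
    · intro Y Z hY hZ
      ext v
      change R.mkQ (covMFDeriv f cov (Y + Z) x v) = _
      rw [covMFDeriv_add hi cov hY hZ]
      exact map_add R.mkQ _ _
  let e (w : TangentSpace 𝓘(ℝ, E) x) : ∀ y : M, TangentSpace 𝓘(ℝ, E) y := FiberBundle.extend E w
  have he (w : TangentSpace 𝓘(ℝ, E) x) : MDiffAt (T% (e w)) x :=
    FiberBundle.mdifferentiableAt_extend 𝓘(ℝ, E) E w
  have hex (w : TangentSpace 𝓘(ℝ, E) x) : e w x = w := FiberBundle.extend_apply_self E w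
  have hval {Y : ∀ y : M, TangentSpace 𝓘(ℝ, E) y} (hY : MDiffAt (T% Y) x)
      (v : TangentSpace 𝓘(ℝ, E) x) : Φ (e (Y x)) v = Φ Y v :=
    congr($(hΦ.pointwise (he _) hY (hex _)) v)
  have hJR (α : Fin 3) : R ≤ R.comap (S'.J α (f x) : _ →ₗ[ℝ] TangentSpace 𝓘(ℝ, E') (f x)) :=
    Submodule.map_le_iff_le_comap.1 (hf.map_tangent α x).le
  let j (α : Fin 3) := R.mapQ R (S'.J α (f x) : _ →ₗ[ℝ] TangentSpace 𝓘(ℝ, E') (f x)) (hJR α)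
  have hJΦ (α : Fin 3) (v w : TangentSpace 𝓘(ℝ, E) x) :
      Φ (e (restrictJ hf α x w)) v = j α (Φ (e w) v) := by
    have h1 := hval (mdifferentiableAt_restrictJ hf α (he w)) v
    simp only [hex] at h1
    rw [h1]
    change R.mkQ (covMFDeriv f cov _ x v) = R.mkQ (S'.J α (f x) (covMFDeriv f cov (e w) x v))
    rw [covMFDeriv_restrictJ hf (hJ α) (he w)]
  have hsymm (v w : TangentSpace 𝓘(ℝ, E) x) : Φ (e w) v = Φ (e v) w := by
    obtain ⟨s⟩ := exists_sliceCharts hi x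
    have hx := s.mem_source
    obtain ⟨v, rfl⟩ := exists_constField_eq s.φ_mem hx v
    obtain ⟨w, rfl⟩ := exists_constField_eq s.φ_mem hx w
    rw [hval (mdifferentiableAt_constField s.φ_mem hx _),
      hval (mdifferentiableAt_constField s.φ_mem hx _)]
    exact congr(R.mkQ $(covMFDeriv_constField_symm hi cov hcov s _ _))
  have h01 (a : TangentSpace 𝓘(ℝ, E') (f x) ⧸ R) : j 0 (j 1 a) = j 2 a := by
    obtain ⟨a, rfl⟩ := R.mkQ_surjective a
    exact congr(R.mkQ $((S'.eq_comp 2 (f x) a).symm))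
  have h10 (a : TangentSpace 𝓘(ℝ, E') (f x) ⧸ R) : -j 1 (j 0 a) = j 2 a := by
    obtain ⟨a, rfl⟩ := R.mkQ_surjective a
    exact congr(R.mkQ $((S'.eq_neg_comp 2 (f x) a).symm))
  have h22 (a : TangentSpace 𝓘(ℝ, E') (f x) ⧸ R) : j 2 (j 2 a) = -a := by
    obtain ⟨a, rfl⟩ := R.mkQ_surjective a
    exact congr(R.mkQ $(S'.sq_eq 2 (f x) a))
  have hzero := eq_zero_of_symm_of_anticommute (β := fun v w ↦ Φ (e w) v) (j₀ := j 0) (j₁ := j 1)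
    hsymm (hJΦ 0) (hJΦ 1) (fun a ↦ by rw [h01, h10]) (fun a ha ↦ by
      rw [h01] at ha
      simpa [ha] using h22 a) v (Y x)
  exact (Submodule.Quotient.mk_eq_zero R).1 ((hval hY v).symm.trans hzero)

theorem mfderiv_inducedConnection (hcov : cov.torsion = 0) (hJ : ∀ α, IsParallel cov (S'.J α))
    {Y : ∀ y : M, TangentSpace 𝓘(ℝ, E) y} {x : M} (hY : MDiffAt (T% Y) x)
    (v : TangentSpace 𝓘(ℝ, E) x) :
    mfderiv 𝓘(ℝ, E) 𝓘(ℝ, E') f x (inducedConnection hf.immersion cov Y x v) =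
      covMFDeriv f cov Y x v := by
  obtain ⟨w, hw⟩ := covMFDeriv_mem_range hf hcov hJ hY v
  replace hw : mfderiv 𝓘(ℝ, E) 𝓘(ℝ, E') f x w = covMFDeriv f cov Y x v := hw
  rw [inducedConnection_apply, ← hw, leftInverse_mfderiv]

theorem isLeviCivita_inducedConnection (hcov : S'.g.IsLeviCivita cov)
    (hJ : ∀ α, IsParallel cov (S'.J α)) :
    (restrict hf).g.IsLeviCivita (inducedConnection hf.immersion cov) where
  torsion_free := torsion_inducedConnection _ _ hcov.torsion_free
  metric x v Y Z hY hZ := by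
    have h := mvfderiv_metric_along hf.immersion cov hcov
      (diffAlongAt_mfderiv hf.immersion.contMDiff hY)
      (diffAlongAt_mfderiv hf.immersion.contMDiff hZ) v
    have h1 := mfderiv_inducedConnection hf hcov.torsion_free hJ hY v
    have h2 := mfderiv_inducedConnection hf hcov.torsion_free hJ hZ v
    rw [(isRestriction_restrict hf).g_eq, (isRestriction_restrict hf).g_eq, h1, h2]
    exact h

theorem isParallel_restrictJ (hcov : S'.g.IsLeviCivita cov)
    (hJ : ∀ α, IsParallel cov (S'.J α)) (α : Fin 3) :
    IsParallel (inducedConnection hf.immersion cov) (restrictJ hf α) := by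
  intro x v Y hY
  rw [sub_eq_zero]
  apply mfderiv_injective hf.immersion x
  rw [mfderiv_inducedConnection hf hcov.torsion_free hJ (mdifferentiableAt_restrictJ hf α hY),
    mfderiv_restrictJ, mfderiv_inducedConnection hf hcov.torsion_free hJ hY,
    covMFDeriv_restrictJ hf (hJ α) hY]

theorem isKManifold_restrict (hS' : S'.IsKManifold) : (restrict hf).IsKManifold := by
  obtain ⟨cov, hcov, hJ⟩ := hS'
  exact ⟨_, isLeviCivita_inducedConnection hf hcov hJ, isParallel_restrictJ hf hcov hJ⟩

omit hf in
theorem HermitianNordenStructure.IsKManifold.isParallel (hS' : S'.IsKManifold)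
    (hcov : S'.g.IsLeviCivita cov) (α : Fin 3) : IsParallel cov (S'.J α) := by
  obtain ⟨c, hc, hJ⟩ := hS'
  intro x v Y hY
  have hJY : MDiffAt (T% (fun y ↦ S'.J α y (Y y))) x :=
    ((S'.smooth α x).mdifferentiableAt (by simp)).clm_bundle_apply hY
  rw [hcov.unique hc hJY, hcov.unique hc hY]
  exact hJ α x v Y hY

theorem isTotallyGeodesic_restrict (hS' : S'.IsKManifold) :
    IsTotallyGeodesic f S'.g (restrict hf).g := by
  intro cov' cov hcov' hcov x v Y hY
  have hJ := hS'.isParallel hcov'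
  rw [secondFundamentalForm, hcov.unique (isLeviCivita_inducedConnection hf hcov' hJ) hY,
    mfderiv_inducedConnection hf hcov'.torsion_free hJ hY]
  exact sub_self _

end Holomorphic

end HyperHN

end

theorem corollary3p1 (m n : ℕ)
    {N : Type*} [TopologicalSpace N] [ChartedSpace (EuclideanSpace ℝ (Fin (4 * n))) N]
    [IsManifold (𝓡 (4 * n)) ∞ N]
    {M : Type*} [TopologicalSpace M] [ChartedSpace (EuclideanSpace ℝ (Fin (4 * m))) M]
    [IsManifold (𝓡 (4 * m)) ∞ M]
    (S' : HyperHN.HermitianNordenStructure (𝓡 (4 * n)) N) (hS' : S'.IsKManifold)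
    (f : M → N) (hf : HyperHN.IsHolomorphicSubmanifold (I := 𝓡 (4 * m)) S' f) :
    ∃ S : HyperHN.HermitianNordenStructure (𝓡 (4 * m)) M,
      HyperHN.IsRestriction f S' S ∧ S.IsKManifold ∧
        HyperHN.IsTotallyGeodesic f S'.g S.g :=
  ⟨HyperHN.restrict hf, HyperHN.isRestriction_restrict hf, HyperHN.isKManifold_restrict hf hS',
    HyperHN.isTotallyGeodesic_restrict hf hS'⟩
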